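/- Let $(M,g)$ be a Riemannian manifold with its Levi-Civita connection, and let geodesics be parametrized on $[0,1]$. For $p,x\in M$ let $G_p^x\subset T_pM$ be the set of initial velocities $\gamma'(0)$ of all length minimizing geodesics $\gamma:[0,1]\to M$ from $p$ to $x$. A direction function at $p$ is a map $\eta_p:M\to T_pM$ with $\eta_p(x)\in G_p^x$ for all $x\in M$. For $\lambda\in(0,1]$ the $\lambda$-radial contraction based at $p$ with respect to $\eta_p$ is the map $\eta_pC^\lambda:M\to M$, $\eta_pC^\lambda(x)=\gamma_{px}(\lambda)$, where $\gamma_{px}$ is the length minimizing geodesic from $p$ to $x$ with $\gamma_{px}'(0)=\eta_p(x)$. The $\lambda$-radial contraction of a geodesic need not be a geodesic, as the following example shows. Let $M=\mathbb{S}^2\subset\mathbb{R}^3$ be the unit sphere with the round metric $ds^2=d\theta^2+\sin^2\theta\,d\phi^2$ ($\theta$ the colatitude, $\phi$ the longitude), let $p$ be the north pole and $\lambda=\tfrac12$. Direction functions $\eta_p$ at $p$ exist. Let $x\neq y$ be two points on the equator. There is a length minimizing geodesic from $x$ to $y$ that runs in the equator. For every direction function $\eta_p$ and every length minimizing geodesic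 $\gamma_{xy}:[0,1]\to\mathbb{S}^2$ from $x$ to $y$ (which, if $y=-x$, is taken to run in the equator), the following hold. 1. There are $a\neq b$ with $|b-a|\le\pi$ such that for all $t\in[0,1]$ the point $\gamma_{xy}(t)$ has coordinates $(\theta,\phi)=(\tfrac{\pi}{2},\,a+t(b-a))$ and the point $\eta_pC^{1/2}(\gamma_{xy}(t))$ has coordinates $(\theta,\phi)=(\tfrac{\pi}{4},\,a+t(b-a))$. In particular $\alpha=\eta_pC^{1/2}(\gamma_{xy})$ is an arc of the latitude circle $\theta=\tfrac{\pi}{4}$. 2. The curve $t\mapsto\eta_pC^{1/2}(\gamma_{xy}(t))$ is not a geodesic, and no geodesic $\sigma:[0,1]\to\mathbb{S}^2$ has the set $\alpha$ as its image. Moreover, no geodesic $\sigma:[0,1]\to\mathbb{S}^2$ has the latitude circle $\theta=\tfrac{\pi}{4}$ as its image. -/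

import Mathlib

open Set Metric Manifold Bundle
open scoped Manifold ContDiff RealInnerProductSpace

noncomputable section

section Riemannian

variable (E : Type*) [NormedAddCommGroup E] [NormedSpace ℝ E]
  {M : Type*} [TopologicalSpace M] [ChartedSpace E M]
  [RiemannianBundle (fun x : M => TangentSpace 𝓘(ℝ, E) x)]

/-- The Riemannian metric read in the preferred chart at `p`: the scalar product `g(v, w)` of two
coordinate vectors `v`, `w` at the coordinate point `u`. -/
def coordMetric (p : M) (u v w : E) : ℝ :=
  inner ℝ (mfderiv 𝓘(ℝ, E) 𝓘(ℝ, E) (extChartAt 𝓘(ℝ, E) p).symm u v)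
    (mfderiv 𝓘(ℝ, E) 𝓘(ℝ, E) (extChartAt 𝓘(ℝ, E) p).symm u w)

/-- The Christoffel symbols of the first kind of the Levi-Civita connection in the preferred chart
at `p`, in coordinate-free notation:
`g(Γ(v, w), z) = (∂_v g(w, z) + ∂_w g(v, z) - ∂_z g(v, w)) / 2` at the coordinate point `u`. -/
def christoffelFirst (p : M) (u v w z : E) : ℝ :=
  (fderiv ℝ (fun y => coordMetric E p y w z) u v
    + fderiv ℝ (fun y => coordMetric E p y v z) u w
    - fderiv ℝ (fun y => coordMetric E p y v w) u z) / 2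

/-- `γ : [0, 1] → M` is a geodesic: it is smooth and its covariant acceleration vanishes. At time
`t` the acceleration is computed in the preferred chart at `γ t`, where the equation
`u'' + Γ(u', u') = 0` is tested against every coordinate vector `z`. The values of `γ` outside
`[0, 1]` play no role (one-sided derivatives at the endpoints). Constant curves are geodesics. -/
def IsGeodesic (γ : ℝ → M) : Prop :=
  ContMDiffOn 𝓘(ℝ, ℝ) 𝓘(ℝ, E) ∞ γ (Icc 0 1) ∧
    ∀ t ∈ Icc (0 : ℝ) 1, ∀ z : E,
      let u : ℝ → E := fun s => extChartAt 𝓘(ℝ, E) (γ t) (γ s)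
      let u' : ℝ → E := derivWithin u (Icc 0 1)
      coordMetric E (γ t) (u t) (derivWithin u' (Icc 0 1) t) z
        + christoffelFirst E (γ t) (u t) (u' t) (u' t) z = 0

/-- `γ : [0, 1] → M` is a length minimizing geodesic from `x` to `y`. -/
def IsMinGeodesic (γ : ℝ → M) (x y : M) : Prop :=
  IsGeodesic E γ ∧ γ 0 = x ∧ γ 1 = y ∧
    pathELength 𝓘(ℝ, E) γ 0 1 = riemannianEDist 𝓘(ℝ, E) x y

/-- `γ` starts at `p` with velocity `γ'(0) = v ∈ T_p M`. -/
def HasInitialVelocity (γ : ℝ → M) (p : M) (v : TangentSpace 𝓘(ℝ, E) p) : Prop :=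
  (⟨γ 0, mfderivWithin 𝓘(ℝ, ℝ) 𝓘(ℝ, E) γ (Icc 0 1) 0 (1 : ℝ)⟩ : TangentBundle 𝓘(ℝ, E) M) = ⟨p, v⟩

/-- The set `G_p^x` of the initial velocities of all length minimizing geodesics from `p` to `x`. -/
def minDirections (p x : M) : Set (TangentSpace 𝓘(ℝ, E) p) :=
  {v | ∃ γ : ℝ → M, IsMinGeodesic E γ p x ∧ HasInitialVelocity E γ p v}

/-- A direction function at `p`: a choice, for every `x`, of a vector `η_p(x) ∈ G_p^x`. -/
structure DirectionFunction (p : M) where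
  /-- The chosen tangent vector. -/
  toFun (x : M) : TangentSpace 𝓘(ℝ, E) p
  mem_minDirections (x : M) : toFun x ∈ minDirections E p x

variable {E}

/-- The `c`-radial contraction based at `p` with respect to the direction function `η`: the point
`γ(c)`, where `γ : [0, 1] → M` is the length minimizing geodesic from `p` to `x` with
`γ'(0) = η(x)`. -/
def DirectionFunction.radialContraction {p : M} (η : DirectionFunction E p) (c : ℝ) (x : M) : M :=
  (η.mem_minDirections x).choose c

end Riemannian

section Sphere

/-- The model space of the two-sphere. -/
abbrev E2 : Type := EuclideanSpace ℝ (Fin 2)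

/-- The ambient Euclidean space of the two-sphere. -/
abbrev E3 : Type := EuclideanSpace ℝ (Fin 3)

/-- The unit sphere in Euclidean three-space. -/
abbrev S2 : Type := sphere (0 : E3) 1

instance factFinrankE3 : Fact (Module.finrank ℝ E3 = 2 + 1) := ⟨by simp⟩

/-- The differential of the inclusion of the sphere in Euclidean three-space. -/
def dIncl (x : S2) : TangentSpace 𝓘(ℝ, E2) x →L[ℝ] E3 :=
  mvfderiv 𝓘(ℝ, E2) ((↑) : S2 → E3) x

/-- The round metric on `T_x S²`: the pullback of the Euclidean scalar product. -/
def roundInner (x : S2) :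
    TangentSpace 𝓘(ℝ, E2) x →L[ℝ] TangentSpace 𝓘(ℝ, E2) x →L[ℝ] ℝ :=
  (ContinuousLinearMap.precomp ℝ (dIncl x)) ∘L (innerSL ℝ (E := E3)) ∘L (dIncl x)

theorem roundInner_apply (x : S2) (v w : TangentSpace 𝓘(ℝ, E2) x) :
    roundInner x v w = inner ℝ (dIncl x v) (dIncl x w) := rfl

theorem dIncl_injective (x : S2) : Function.Injective (dIncl x) :=
  injective_mvfderiv_subtypeVal_sphere x

theorem isVonNBounded_roundInner (x : S2) :
    Bornology.IsVonNBounded ℝ {v : TangentSpace 𝓘(ℝ, E2) x | roundInner x v v < 1} := by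
  let D : E2 →L[ℝ] E3 := dIncl x
  have hD : Function.Injective D := dIncl_injective x
  change Bornology.IsVonNBounded ℝ {v : E2 | ⟪D v, D v⟫ < 1}
  obtain ⟨K, -, hK⟩ := LinearMap.exists_antilipschitzWith (D : E2 →ₗ[ℝ] E3)
    (LinearMap.ker_eq_bot.2 hD)
  rw [NormedSpace.isVonNBounded_iff]
  refine (hK.isBounded_preimage (Metric.isBounded_ball (x := (0 : E3)) (r := 1))).subset ?_
  intro v hv
  have hv' : ⟪D v, D v⟫ < 1 := hv
  rw [real_inner_self_eq_norm_sq] at hv'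
  have : ‖D v‖ < 1 := by nlinarith [norm_nonneg (D v)]
  simpa using this

theorem contMDiff_roundInner :
    ContMDiff 𝓘(ℝ, E2) (𝓘(ℝ, E2).prod 𝓘(ℝ, E2 →L[ℝ] E2 →L[ℝ] ℝ)) ∞
      (fun x => Bundle.TotalSpace.mk' (E2 →L[ℝ] E2 →L[ℝ] ℝ)
        (E := fun x : S2 => TangentSpace 𝓘(ℝ, E2) x →L[ℝ] TangentSpace 𝓘(ℝ, E2) x →L[ℝ] ℝ)
        x (roundInner x)) := by
  intro x₀
  rw [contMDiffAt_section]
  have h := ContMDiffAt.mfderiv_const (m := ∞) (n := ω)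
    ((contMDiff_coe_sphere (E := E3) (n := 2) (m := ω)).contMDiffAt (x := x₀)) (by simp)
  have h2 : ContMDiffAt 𝓘(ℝ, E2) 𝓘(ℝ, E2 →L[ℝ] E2 →L[ℝ] ℝ) ∞
     (fun x =>
       let D : E2 →L[ℝ] E3 := inTangentCoordinates 𝓘(ℝ, E2) 𝓘(ℝ, E3) id ((↑) : S2 → E3)
         (mfderiv 𝓘(ℝ, E2) 𝓘(ℝ, E3) ((↑) : S2 → E3)) x₀ x
       (ContinuousLinearMap.precomp ℝ D) ∘L (innerSL ℝ (E := E3)) ∘L D) x₀ := by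
    let Φ : (E2 →L[ℝ] E3) → (E2 →L[ℝ] E2 →L[ℝ] ℝ) := fun D =>
       (ContinuousLinearMap.precomp ℝ D) ∘L (innerSL ℝ (E := E3)) ∘L D
    have hΦ : ContDiff ℝ ∞ Φ := by
      have : Φ = fun D => ((ContinuousLinearMap.compL ℝ E2 E3 ℝ).flip D) ∘L
          ((innerSL ℝ (E := E3)) ∘L D) := by
        ext; rfl
      rw [this]
      fun_prop
    exact hΦ.contDiffAt.contMDiffAt.comp x₀ h
  refine h2.congr_of_eventuallyEq ?_
  filter_upwards [(chartAt E2 x₀).open_source.mem_nhds (mem_chart_source E2 x₀)] with x hx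
  ext v w
  rw [hom_trivializationAt_apply]
  dsimp only
  rw [ContinuousLinearMap.inCoordinates_eq (by simpa using hx) (by simpa using hx)]
  simp [inTangentCoordinates, ContinuousLinearMap.inCoordinates]
  rw [hom_trivializationAt_apply]
  simp [ContinuousLinearMap.inCoordinates]
  rw [roundInner_apply, ← Trivialization.symmL_apply (R := ℝ)
    (e := trivializationAt E2 (TangentSpace 𝓘(ℝ, E2)) x₀) (by simpa using hx)]
  rfl

/-- The round metric of the sphere as a smooth Riemannian metric. -/
def roundMetric : ContMDiffRiemannianMetric 𝓘(ℝ, E2) ∞ E2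
    (fun x : S2 => TangentSpace 𝓘(ℝ, E2) x) where
  inner := roundInner
  symm x v w := by simp only [roundInner_apply, real_inner_comm]
  pos x v hv := by
    rw [roundInner_apply]
    exact real_inner_self_pos.2 fun h => hv (dIncl_injective x (by simpa using h))
  isVonNBounded := isVonNBounded_roundInner
  contMDiff := contMDiff_roundInner

instance riemannianBundleS2 : RiemannianBundle (fun x : S2 => TangentSpace 𝓘(ℝ, E2) x) :=
  ⟨roundMetric.toRiemannianMetric⟩

/-- The point of the sphere with colatitude `θ` and longitude `φ`; in these coordinates the round
metric is `dθ² + sin² θ dφ²`. -/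
def polar (θ φ : ℝ) : S2 :=
  ⟨!₂[Real.sin θ * Real.cos φ, Real.sin θ * Real.sin φ, Real.cos θ], by
    rw [mem_sphere_zero_iff_norm, EuclideanSpace.norm_eq, Real.sqrt_eq_one]
    simp only [Fin.sum_univ_three, Real.norm_eq_abs, sq_abs]
    simp
    nlinarith [Real.sin_sq_add_cos_sq θ, Real.sin_sq_add_cos_sq φ]⟩

/-- The latitude circle of colatitude `θ`. -/
def latitudeCircle (θ : ℝ) : Set S2 := range (polar θ)

/-- The equator. -/
def equator : Set S2 := {x | (x : E3) 2 = 0}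

/-- The north pole. -/
def northPole : S2 := ⟨!₂[0, 0, 1], by
  simp [EuclideanSpace.norm_eq, Fin.sum_univ_three]⟩

end Sphere

end

/-! The round metric is pulled back from Euclidean space, so the covariant acceleration of a curve
in the sphere is the tangential part of its ambient acceleration, and a geodesic is a smooth curve
whose ambient acceleration is radial (`isGeodesic_iff`). Solving `c'' = -|c'|² c` leaves only
constants and great circle arcs at constant speed (`eq_const_or_great_arc`).

A curve on the sphere is at least as long as the angle between its endpoints
(`arccos_inner_le_integral`). Hence great circle arcs of angle at most `π` minimize, and no
nonconstant minimizing geodesic has a larger angle.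

The angle from the north pole to an equatorial point is `π / 2`, so the minimizing geodesic on `[0,
1]` is unique and its midpoint is the point of colatitude `π / 4` with the same longitude, whatever
the direction function. Equatorial arcs thus contract to curves of constant nonzero height. Along a
great circle the height is `A cos s + B sin s`, which is not constant on an interval unless it
vanishes there, so a geodesic inside such a latitude circle is a single point. -/

/-! ### Geodesics of the sphere in terms of ambient acceleration -/

/-- The inverse of the preferred chart at `p`, followed by the inclusion in Euclidean space. -/
noncomputable def chartEmb (p : S2) (u : E2) : E3 := ((extChartAt 𝓘(ℝ, E2) p).symm u : S2)

theorem extChartAt_target_S2 (p : S2) : (extChartAt 𝓘(ℝ, E2) p).target = univ := by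
  rw [extChartAt_target]
  simp [chartAt, ChartedSpace.chartAt]

theorem contMDiff_extChartAt_symm_S2 {n : ℕ∞ω} (p : S2) :
    ContMDiff 𝓘(ℝ, E2) 𝓘(ℝ, E2) n (extChartAt 𝓘(ℝ, E2) p).symm := by
  have h := contMDiffOn_extChartAt_symm (I := 𝓘(ℝ, E2)) (n := ω) p
  rw [extChartAt_target_S2, contMDiffOn_univ] at h
  exact h.of_le le_top

theorem mdifferentiableAt_coe_S2 (x : S2) :
    MDifferentiableAt 𝓘(ℝ, E2) 𝓘(ℝ, E3) ((↑) : S2 → E3) x :=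
  ((contMDiff_coe_sphere (E := E3) (n := 2) (m := 1)) x).mdifferentiableAt one_ne_zero

theorem contDiff_chartEmb {n : ℕ∞ω} (p : S2) : ContDiff ℝ n (chartEmb p) := by
  rw [← contMDiff_iff_contDiff]
  exact (contMDiff_coe_sphere (E := E3) (n := 2)).comp (contMDiff_extChartAt_symm_S2 p)

theorem fderiv_chartEmb (p : S2) (u v : E2) :
    fderiv ℝ (chartEmb p) u v = dIncl ((extChartAt 𝓘(ℝ, E2) p).symm u)
      (mfderiv 𝓘(ℝ, E2) 𝓘(ℝ, E2) (extChartAt 𝓘(ℝ, E2) p).symm u v) := by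
  have h := mfderiv_comp u (mdifferentiableAt_coe_S2 ((extChartAt 𝓘(ℝ, E2) p).symm u))
    ((contMDiff_extChartAt_symm_S2 (n := 1) p u).mdifferentiableAt one_ne_zero)
  rw [← mfderiv_eq_fderiv]
  exact congrArg (fun D : E2 →L[ℝ] E3 => D v) h

theorem norm_tangent_eq (x : S2) (v : TangentSpace 𝓘(ℝ, E2) x) : ‖v‖ = ‖dIncl x v‖ := by
  rw [norm_eq_sqrt_real_inner, norm_eq_sqrt_real_inner]
  rfl

theorem coordMetric_eq (p : S2) (u v w : E2) :
    coordMetric E2 p u v w = ⟪fderiv ℝ (chartEmb p) u v, fderiv ℝ (chartEmb p) u w⟫ := by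
  rw [fderiv_chartEmb, fderiv_chartEmb]
  rfl

/-- The inverse chart has invertible derivative and the inclusion maps the tangent space onto the
orthogonal complement of the point. Testing the geodesic equation on coordinate vectors therefore
tests it on every ambient tangent vector. -/
theorem range_fderiv_chartEmb (p : S2) (u : E2) (w : E3) (hw : ⟪chartEmb p u, w⟫ = 0) :
    ∃ z, fderiv ℝ (chartEmb p) u z = w := by
  have hw' : w ∈ (mvfderiv 𝓘(ℝ, E2) ((↑) : S2 → E3)
      ((extChartAt 𝓘(ℝ, E2) p).symm u)).range := by
    rw [range_mvfderiv_subtypeVal, Submodule.mem_orthogonal_singleton_iff_inner_right]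
    exact hw
  obtain ⟨v, hv⟩ := hw'
  have hinv := isInvertible_mfderivWithin_extChartAt_symm (I := 𝓘(ℝ, E2)) (x := p) (y := u)
    (extChartAt_target_S2 p ▸ mem_univ u)
  rw [show range 𝓘(ℝ, E2) = univ by simp, mfderivWithin_univ] at hinv
  obtain ⟨A, hA⟩ := hinv
  refine ⟨A.symm v, ?_⟩
  refine (fderiv_chartEmb p u _).trans (Eq.trans ?_ hv)
  rw [← hA]
  exact congrArg _ (A.apply_symm_apply v)

theorem inner_fderiv_chartEmb (p : S2) (u z : E2) :
    ⟪chartEmb p u, fderiv ℝ (chartEmb p) u z⟫ = 0 := by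
  have hd : DifferentiableAt ℝ (chartEmb p) u :=
    (contDiff_chartEmb (n := 1) p).differentiable one_ne_zero u
  have h1 : fderiv ℝ (fun y => ⟪chartEmb p y, chartEmb p y⟫) u z = 0 := by
    have : (fun y => ⟪chartEmb p y, chartEmb p y⟫) = fun _ => (1 : ℝ) := by
      funext y
      simp [chartEmb]
    rw [this]; simp
  rw [fderiv_inner_apply ℝ hd hd, real_inner_comm (chartEmb p u)] at h1
  linarith

theorem fderiv_coordMetric (p : S2) (u v w z : E2) :
    fderiv ℝ (fun y => coordMetric E2 p y w z) u v =
      ⟪fderiv ℝ (chartEmb p) u w, fderiv ℝ (fderiv ℝ (chartEmb p)) u v z⟫ +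
      ⟪fderiv ℝ (fderiv ℝ (chartEmb p)) u v w, fderiv ℝ (chartEmb p) u z⟫ := by
  have hd : DifferentiableAt ℝ (fderiv ℝ (chartEmb p)) u :=
    ((contDiff_chartEmb (n := 2) p).fderiv_right (m := 1) one_add_one_eq_two.le).differentiable
      one_ne_zero u
  have h (w : E2) : HasFDerivAt (fun y => fderiv ℝ (chartEmb p) y w)
    ((ContinuousLinearMap.apply ℝ E3 w).comp (fderiv ℝ (fderiv ℝ (chartEmb p)) u)) u :=
    ((ContinuousLinearMap.apply ℝ E3 w).hasFDerivAt).comp u hd.hasFDerivAt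
  simp_rw [coordMetric_eq]
  rw [fderiv_inner_apply ℝ (h w).differentiableAt (h z).differentiableAt, (h w).fderiv,
    (h z).fderiv]
  rfl

/-- With `F = chartEmb p` and `g(v, w) = ⟪DF v, DF w⟫`, the terms `⟪DF v, D²F(v, z)⟫` and `⟪DF v,
D²F(z, v)⟫` cancel by symmetry of the second derivative. -/
theorem christoffelFirst_eq (p : S2) (u v z : E2) :
    christoffelFirst E2 p u v v z =
      ⟪fderiv ℝ (fderiv ℝ (chartEmb p)) u v v, fderiv ℝ (chartEmb p) u z⟫ := by
  have hs : fderiv ℝ (fderiv ℝ (chartEmb p)) u v z = fderiv ℝ (fderiv ℝ (chartEmb p)) u z v :=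
    ((contDiff_chartEmb (n := 2) p).contDiffAt.isSymmSndFDerivAt (by simp)) v z
  rw [christoffelFirst]
  simp only [fderiv_coordMetric]
  rw [hs, real_inner_comm (fderiv ℝ (chartEmb p) u v)]
  ring

theorem ContMDiffOn.coe_S2 {n : ℕ∞ω} {γ : ℝ → S2} {s : Set ℝ}
    (hγ : ContMDiffOn 𝓘(ℝ, ℝ) 𝓘(ℝ, E2) n γ s) : ContDiffOn ℝ n (fun t => (γ t : E3)) s := by
  rw [← contMDiffOn_iff_contDiffOn]
  exact (contMDiff_coe_sphere (E := E3) (n := 2)).comp_contMDiffOn hγ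

theorem chartEmb_extChartAt {p x : S2} (hx : x ∈ (extChartAt 𝓘(ℝ, E2) p).source) :
    chartEmb p (extChartAt 𝓘(ℝ, E2) p x) = x :=
  congrArg Subtype.val ((extChartAt 𝓘(ℝ, E2) p).left_inv hx)

/-- The covariant acceleration in a chart is the tangential part of the ambient acceleration. -/
theorem chart_acceleration_eq {γ : ℝ → S2}
    (hγ : ContMDiffOn 𝓘(ℝ, ℝ) 𝓘(ℝ, E2) ∞ γ (Icc 0 1)) {t : ℝ} (ht : t ∈ Icc (0 : ℝ) 1)
    {u : ℝ → E2} (hu : u = fun s => extChartAt 𝓘(ℝ, E2) (γ t) (γ s)) (z : E2) :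
    coordMetric E2 (γ t) (u t) (derivWithin (derivWithin u (Icc 0 1)) (Icc 0 1) t) z
        + christoffelFirst E2 (γ t) (u t) (derivWithin u (Icc 0 1) t)
          (derivWithin u (Icc 0 1) t) z =
      ⟪derivWithin (derivWithin (fun s => (γ s : E3)) (Icc 0 1)) (Icc 0 1) t,
        fderiv ℝ (chartEmb (γ t)) (u t) z⟫ := by
  have hI : UniqueDiffOn ℝ (Icc (0 : ℝ) 1) := uniqueDiffOn_Icc one_pos
  have hu2 : ContDiffWithinAt ℝ 2 u (Icc 0 1) t := by
    rw [← contMDiffWithinAt_iff_contDiffWithinAt, hu]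
    exact (contMDiffAt_extChartAt (I := 𝓘(ℝ, E2)) (n := 2) (x := γ t)).comp_contMDiffWithinAt t
      ((hγ t ht).of_le (WithTop.coe_le_coe.2 (le_top : (2 : ℕ∞) ≤ ⊤)))
  have hev : ∀ᶠ s in nhdsWithin t (Icc 0 1), (γ s : E3) = chartEmb (γ t) (u s) := by
    filter_upwards [(hγ t ht).continuousWithinAt
      (extChartAt_source_mem_nhds (I := 𝓘(ℝ, E2)) (γ t))] with s hs
    rw [hu, chartEmb_extChartAt hs]
  have hev2 : ∀ᶠ s in nhdsWithin t (Icc 0 1), ContDiffWithinAt ℝ 2 u (Icc 0 1) s := by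
    have := hu2.eventually (by simp)
    rwa [insert_eq_of_mem ht] at this
  have hF : ∀ x, HasFDerivAt (chartEmb (γ t)) (fderiv ℝ (chartEmb (γ t)) x) x := fun x =>
    ((contDiff_chartEmb (n := 1) (γ t)).differentiable one_ne_zero x).hasFDerivAt
  have hF2 : ∀ x, HasFDerivAt (fderiv ℝ (chartEmb (γ t)))
      (fderiv ℝ (fderiv ℝ (chartEmb (γ t))) x) x := fun x =>
    (((contDiff_chartEmb (n := 2) (γ t)).fderiv_right (m := 1)
      one_add_one_eq_two.le).differentiable one_ne_zero x).hasFDerivAt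
  have hc1 : derivWithin (fun s => (γ s : E3)) (Icc 0 1) =ᶠ[nhdsWithin t (Icc 0 1)]
      fun s => fderiv ℝ (chartEmb (γ t)) (u s) (derivWithin u (Icc 0 1) s) := by
    filter_upwards [eventually_eventually_nhdsWithin.2 hev, hev2, self_mem_nhdsWithin]
      with s hs hs2 hsI
    rw [Filter.EventuallyEq.derivWithin_eq_of_mem hs hsI]
    exact ((hF (u s)).comp_hasDerivWithinAt s
      (hs2.differentiableWithinAt two_ne_zero).hasDerivWithinAt).derivWithin (hI s hsI)
  have hu' : DifferentiableWithinAt ℝ (derivWithin u (Icc 0 1)) (Icc 0 1) t :=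
    (hu2.derivWithin (m := 1) hI one_add_one_eq_two.le ht).differentiableWithinAt one_ne_zero
  have h1 := ((hF2 (u t)).comp_hasDerivWithinAt t
    (hu2.differentiableWithinAt two_ne_zero).hasDerivWithinAt).clm_apply hu'.hasDerivWithinAt
  rw [hc1.derivWithin_eq_of_mem ht]
  erw [h1.derivWithin (hI t ht)]
  rw [coordMetric_eq, christoffelFirst_eq, inner_add_left, add_comm]
  rfl

theorem isGeodesic_iff {γ : ℝ → S2} :
    IsGeodesic E2 γ ↔ ContMDiffOn 𝓘(ℝ, ℝ) 𝓘(ℝ, E2) ∞ γ (Icc 0 1) ∧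
      ∀ t ∈ Icc (0 : ℝ) 1, ∃ k : ℝ,
        derivWithin (derivWithin (fun s => (γ s : E3)) (Icc 0 1)) (Icc 0 1) t = k • (γ t : E3) := by
  refine and_congr_right fun hγ => forall₂_congr fun t ht => ?_
  have hc : chartEmb (γ t) (extChartAt 𝓘(ℝ, E2) (γ t) (γ t)) = γ t :=
    chartEmb_extChartAt (mem_extChartAt_source _)
  constructor
  · intro h
    have h' : ∀ w : E3, ⟪(γ t : E3), w⟫ = 0 →
        ⟪derivWithin (derivWithin (fun s => (γ s : E3)) (Icc 0 1)) (Icc 0 1) t, w⟫ = 0 := by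
      intro w hw
      obtain ⟨z, rfl⟩ := range_fderiv_chartEmb (γ t) (extChartAt 𝓘(ℝ, E2) (γ t) (γ t)) w
        (by rwa [hc])
      exact (chart_acceleration_eq hγ ht rfl z).symm.trans (h z)
    generalize derivWithin (derivWithin (fun s => (γ s : E3)) (Icc 0 1)) (Icc 0 1) t = a at h'
    have hn : ⟪(γ t : E3), (γ t : E3)⟫ = 1 := by simp
    -- The tangential part of `a` is orthogonal both to `γ t` and, being tangent, to `a`; hence to
    -- itself.
    have h1 : ⟪(γ t : E3), a - ⟪(γ t : E3), a⟫ • (γ t : E3)⟫ = 0 := by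
      rw [inner_sub_right, inner_smul_right, hn]; ring
    have h2 := h' _ h1
    refine ⟨⟪(γ t : E3), a⟫, ?_⟩
    rw [← sub_eq_zero, ← inner_self_eq_zero (𝕜 := ℝ), inner_sub_left, h2, inner_smul_left, h1]
    simp
  · rintro ⟨k, hk⟩ z
    refine (chart_acceleration_eq hγ ht rfl z).trans ?_
    rw [hk, inner_smul_left]
    have := inner_fderiv_chartEmb (γ t) (extChartAt 𝓘(ℝ, E2) (γ t) (γ t)) z
    rw [hc] at this
    rw [this, mul_zero]

/-! ### Curves with radial acceleration are great circle arcs -/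

theorem eq_zero_of_hasDerivWithinAt_Icc_of_eqOn_const {F : Type*} [NormedAddCommGroup F]
    [NormedSpace ℝ F] {f : ℝ → F} {f' k : F} {t : ℝ} (ht : t ∈ Icc (0 : ℝ) 1)
    (hf : HasDerivWithinAt f f' (Icc 0 1) t) (hk : ∀ s ∈ Icc (0 : ℝ) 1, f s = k) : f' = 0 := by
  have h := (hasDerivWithinAt_const t (Icc (0 : ℝ) 1) k).congr hk (hk t ht)
  exact (uniqueDiffOn_Icc one_pos t ht).eq_deriv _ hf h

theorem eq_of_hasDerivWithinAt_Icc_zero {F : Type*} [NormedAddCommGroup F]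
    [NormedSpace ℝ F] {f : ℝ → F}
    (hf : ∀ t ∈ Icc (0 : ℝ) 1, HasDerivWithinAt f 0 (Icc 0 1) t) :
    ∀ t ∈ Icc (0 : ℝ) 1, f t = f 0 :=
  constant_of_derivWithin_zero (fun t ht => (hf t ht).differentiableWithinAt) fun t ht =>
    (hf t (Ico_subset_Icc_self ht)).derivWithin
      (uniqueDiffOn_Icc one_pos t (Ico_subset_Icc_self ht))

theorem hasDerivAt_cos_mul (α t : ℝ) :
    HasDerivAt (fun t => Real.cos (α * t)) (-(α * Real.sin (α * t))) t := by
  have h := ((hasDerivAt_id t).const_mul α).cos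
  simp only [id, mul_one] at h
  convert h using 1
  ring

theorem hasDerivAt_sin_mul (α t : ℝ) :
    HasDerivAt (fun t => Real.sin (α * t)) (α * Real.cos (α * t)) t := by
  have h := ((hasDerivAt_id t).const_mul α).sin
  simp only [id, mul_one] at h
  convert h using 1
  ring

/-- A curve on the unit sphere whose acceleration is radial is constant or runs in a great circle
at constant speed. -/
theorem eq_const_or_great_arc {F : Type*} [NormedAddCommGroup F] [InnerProductSpace ℝ F]
    {c : ℝ → F} (hc : ContDiffOn ℝ 2 c (Icc 0 1)) (hn : ∀ t, ‖c t‖ = 1)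
    (hk : ∀ t ∈ Icc (0 : ℝ) 1, ∃ k : ℝ,
      derivWithin (derivWithin c (Icc 0 1)) (Icc 0 1) t = k • c t) :
    (∀ t ∈ Icc (0 : ℝ) 1, c t = c 0) ∨ ∃ α > 0, ∃ e : F, ‖e‖ = 1 ∧ ⟪c 0, e⟫ = 0 ∧
      ∀ t ∈ Icc (0 : ℝ) 1, c t = Real.cos (α * t) • c 0 + Real.sin (α * t) • e := by
  have hI : UniqueDiffOn ℝ (Icc (0 : ℝ) 1) := uniqueDiffOn_Icc one_pos
  have h0 : (0 : ℝ) ∈ Icc (0 : ℝ) 1 := ⟨le_rfl, zero_le_one⟩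
  set c' := derivWithin c (Icc 0 1) with hc'
  set c'' := derivWithin c' (Icc 0 1) with hc''
  have hd : ∀ t ∈ Icc (0 : ℝ) 1, HasDerivWithinAt c (c' t) (Icc 0 1) t := fun t ht =>
    (hc.differentiableOn two_ne_zero t ht).hasDerivWithinAt
  have hd' : ∀ t ∈ Icc (0 : ℝ) 1, HasDerivWithinAt c' (c'' t) (Icc 0 1) t := fun t ht =>
    ((hc.derivWithin (m := 1) hI one_add_one_eq_two.le).differentiableOn
      one_ne_zero t ht).hasDerivWithinAt
  have hcc : ∀ t, ⟪c t, c t⟫ = 1 := fun t => by simp [hn]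
  have hcc' : ∀ t ∈ Icc (0 : ℝ) 1, ⟪c t, c' t⟫ = 0 := by
    intro t ht
    have := eq_zero_of_hasDerivWithinAt_Icc_of_eqOn_const ht
      ((hd t ht).inner ℝ (hd t ht)) (fun s _ => hcc s)
    rw [real_inner_comm (c t)] at this
    linarith
  have hcc'' : ∀ t ∈ Icc (0 : ℝ) 1, ⟪c t, c'' t⟫ + ⟪c' t, c' t⟫ = 0 := fun t ht =>
    eq_zero_of_hasDerivWithinAt_Icc_of_eqOn_const ht ((hd t ht).inner ℝ (hd' t ht)) hcc'
  -- Differentiating `⟪c, c'⟫ = 0` forces the radial factor to be `-|c'|²`; then `c''` is orthogonal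
  -- to `c'`, so the speed is constant.
  have hrad : ∀ t ∈ Icc (0 : ℝ) 1, c'' t = -⟪c' t, c' t⟫ • c t := by
    intro t ht
    obtain ⟨k, hk⟩ := hk t ht
    have h := hcc'' t ht
    rw [hk, inner_smul_right, hcc] at h
    rw [hk]
    congr 1
    linarith
  have hsp : ∀ t ∈ Icc (0 : ℝ) 1, ⟪c' t, c' t⟫ = ⟪c' 0, c' 0⟫ := by
    refine eq_of_hasDerivWithinAt_Icc_zero (f := fun t => ⟪c' t, c' t⟫) fun t ht => ?_
    refine ((hd' t ht).inner ℝ (hd' t ht)).congr_deriv ?_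
    rw [hrad t ht, inner_smul_left, inner_smul_right, hcc' t ht, real_inner_comm (c t) (c' t), hcc' t ht]
    simp
  set α := ‖c' 0‖ with hα
  rw [real_inner_self_eq_norm_sq, ← hα] at hsp
  rcases (norm_nonneg (c' 0)).eq_or_lt with h | hpos
  · left
    refine eq_of_hasDerivWithinAt_Icc_zero fun t ht => ?_
    have := hsp t ht
    rw [hα, ← h, sq, mul_zero, inner_self_eq_zero] at this
    exact this ▸ hd t ht
  · right
    rw [← hα] at hpos
    have hne : α ≠ 0 := hpos.ne'
    -- Since `c'' = -α² c`, the pair `(c, α⁻¹ c')` rotates with angular speed `α`. Rotating it back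
    -- by `α t` gives the constants of `hA` and `hB`, and inverting this rotation gives the formula
    -- for `c`.
    have hA : ∀ t ∈ Icc (0 : ℝ) 1,
        Real.cos (α * t) • c t - (Real.sin (α * t) * α⁻¹) • c' t = c 0 := by
      intro t ht
      refine (eq_of_hasDerivWithinAt_Icc_zero (f := fun t =>
        Real.cos (α * t) • c t - (Real.sin (α * t) * α⁻¹) • c' t) (fun t ht => ?_) t ht).trans
        (by simp)
      convert ((hasDerivAt_cos_mul α t).hasDerivWithinAt.fun_smul (hd t ht)).fun_sub
        (((hasDerivAt_sin_mul α t).hasDerivWithinAt.mul_const α⁻¹).fun_smul (hd' t ht)) using 1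
      rw [hrad t ht, hsp t ht]
      match_scalars <;> field_simp <;> ring
    have hB : ∀ t ∈ Icc (0 : ℝ) 1,
        Real.sin (α * t) • c t + (Real.cos (α * t) * α⁻¹) • c' t = α⁻¹ • c' 0 := by
      intro t ht
      refine (eq_of_hasDerivWithinAt_Icc_zero (f := fun t =>
        Real.sin (α * t) • c t + (Real.cos (α * t) * α⁻¹) • c' t) (fun t ht => ?_) t ht).trans
        (by simp)
      convert ((hasDerivAt_sin_mul α t).hasDerivWithinAt.fun_smul (hd t ht)).fun_add
        (((hasDerivAt_cos_mul α t).hasDerivWithinAt.mul_const α⁻¹).fun_smul (hd' t ht)) using 1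
      rw [hrad t ht, hsp t ht]
      match_scalars <;> field_simp <;> ring
    refine ⟨α, hpos, α⁻¹ • c' 0, ?_, ?_, fun t ht => ?_⟩
    · rw [norm_smul, ← hα, Real.norm_of_nonneg (inv_nonneg.2 hpos.le), inv_mul_cancel₀ hne]
    · rw [inner_smul_right, hcc' 0 h0, mul_zero]
    · rw [← hB t ht, ← hA t ht]
      match_scalars
      · linear_combination -Real.sin_sq_add_cos_sq (α * t)
      · ring

theorem IsGeodesic.eq_const_or_great_arc {γ : ℝ → S2} (hγ : IsGeodesic E2 γ) :
    (∀ t ∈ Icc (0 : ℝ) 1, γ t = γ 0) ∨ ∃ α > 0, ∃ e : E3, ‖e‖ = 1 ∧ ⟪(γ 0 : E3), e⟫ = 0 ∧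
      ∀ t ∈ Icc (0 : ℝ) 1,
        (γ t : E3) = Real.cos (α * t) • (γ 0 : E3) + Real.sin (α * t) • e := by
  obtain ⟨h1, h2⟩ := isGeodesic_iff.1 hγ
  refine (_root_.eq_const_or_great_arc (c := fun t => (γ t : E3))
    (h1.coe_S2.of_le (WithTop.coe_le_coe.2 (le_top : (2 : ℕ∞) ≤ ⊤))) (fun t => by simp) h2).imp
    (fun h t ht => Subtype.ext (h t ht)) id

theorem great_arc_mem_sphere {p e : E3} (hp : ‖p‖ = 1) (he : ‖e‖ = 1) (hpe : ⟪p, e⟫ = 0) (s : ℝ) :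
    Real.cos s • p + Real.sin s • e ∈ sphere (0 : E3) 1 := by
  rw [mem_sphere_zero_iff_norm, ← sq_eq_sq₀ (norm_nonneg _) zero_le_one,
    ← real_inner_self_eq_norm_sq]
  simp only [inner_add_left, inner_add_right, inner_smul_left, inner_smul_right,
    real_inner_self_eq_norm_sq, hp, he, hpe, real_inner_comm p e]
  simp
  nlinarith [Real.sin_sq_add_cos_sq s]

/-- The point at angle `s` from `p` on the great circle through the orthonormal vectors `p`, `e`. -/
noncomputable def greatCircle {p e : E3} (hp : ‖p‖ = 1) (he : ‖e‖ = 1) (hpe : ⟪p, e⟫ = 0) (s : ℝ) : S2 :=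
  ⟨Real.cos s • p + Real.sin s • e, great_arc_mem_sphere hp he hpe s⟩

theorem hasDerivAt_great_arc (p e : E3) (α t : ℝ) :
    HasDerivAt (fun t => Real.cos (α * t) • p + Real.sin (α * t) • e)
      (α • (Real.cos (α * t) • e - Real.sin (α * t) • p)) t := by
  refine (((hasDerivAt_cos_mul α t).smul_const p).fun_add
    ((hasDerivAt_sin_mul α t).smul_const e)).congr_deriv ?_
  module

theorem isGeodesic_greatCircle {p e : E3} (hp : ‖p‖ = 1) (he : ‖e‖ = 1) (hpe : ⟪p, e⟫ = 0)
    (α : ℝ) : IsGeodesic E2 (fun t => greatCircle hp he hpe (α * t)) := by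
  have hI : UniqueDiffOn ℝ (Icc (0 : ℝ) 1) := uniqueDiffOn_Icc one_pos
  refine isGeodesic_iff.2 ⟨ContMDiff.contMDiffOn ?_, fun t ht => ⟨-α ^ 2, ?_⟩⟩
  · refine ContMDiff.codRestrict_sphere (n := 2)
      (f := fun t : ℝ => Real.cos (α * t) • p + Real.sin (α * t) • e) ?_
      (fun t => great_arc_mem_sphere hp he hpe (α * t))
    rw [contMDiff_iff_contDiff]
    fun_prop
  · have h1 : EqOn (derivWithin (fun t => (greatCircle hp he hpe (α * t) : E3)) (Icc 0 1))
        (fun t => α • (Real.cos (α * t) • e - Real.sin (α * t) • p)) (Icc 0 1) := fun s hs =>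
      (hasDerivAt_great_arc p e α s).hasDerivWithinAt.derivWithin (hI s hs)
    rw [derivWithin_congr h1 (h1 ht)]
    refine (HasDerivAt.hasDerivWithinAt ?_).derivWithin (hI t ht)
    refine ((((hasDerivAt_cos_mul α t).smul_const e).fun_sub
      ((hasDerivAt_sin_mul α t).smul_const p)).const_smul α).congr_deriv ?_
    simp only [greatCircle]
    module

/-! ### Length and Riemannian distance -/

theorem pathELength_S2_eq {γ : ℝ → S2}
    (hγ : ContMDiffOn 𝓘(ℝ, ℝ) 𝓘(ℝ, E2) 1 γ (Icc 0 1)) :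
    pathELength 𝓘(ℝ, E2) γ 0 1 =
      ∫⁻ t in Icc (0 : ℝ) 1, ‖derivWithin (fun s => (γ s : E3)) (Icc 0 1) t‖ₑ := by
  rw [pathELength_eq_lintegral_mfderivWithin_Icc]
  refine MeasureTheory.setLIntegral_congr_fun measurableSet_Icc fun t ht => ?_
  have hu : UniqueMDiffWithinAt 𝓘(ℝ, ℝ) (Icc (0 : ℝ) 1) t :=
    (uniqueDiffOn_Icc one_pos t ht).uniqueMDiffWithinAt
  have h := mfderiv_comp_mfderivWithin t (mdifferentiableAt_coe_S2 (γ t))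
    (hγ.mdifferentiableOn one_ne_zero t ht) hu
  rw [mfderivWithin_eq_fderivWithin] at h
  have h1 : dIncl (γ t) (mfderivWithin 𝓘(ℝ, ℝ) 𝓘(ℝ, E2) γ (Icc 0 1) t (1 : ℝ)) =
      derivWithin (fun s => (γ s : E3)) (Icc 0 1) t := by
    rw [← fderivWithin_derivWithin]
    exact (congrArg (fun D : ℝ →L[ℝ] E3 => D 1) h).symm
  rw [← h1]
  have h2 := norm_tangent_eq (γ t) (mfderivWithin 𝓘(ℝ, ℝ) 𝓘(ℝ, E2) γ (Icc 0 1) t (1 : ℝ))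
  rw [← ofReal_norm, ← ofReal_norm]
  exact congrArg ENNReal.ofReal h2

/-- The length of a great circle arc. -/
theorem pathELength_great_arc {γ : ℝ → S2}
    (hγ : ContMDiffOn 𝓘(ℝ, ℝ) 𝓘(ℝ, E2) 1 γ (Icc 0 1)) {p e : E3} (hp : ‖p‖ = 1) (he : ‖e‖ = 1)
    (hpe : ⟪p, e⟫ = 0) {α : ℝ} (hα : 0 ≤ α)
    (h : ∀ t ∈ Icc (0 : ℝ) 1, (γ t : E3) = Real.cos (α * t) • p + Real.sin (α * t) • e) :
    pathELength 𝓘(ℝ, E2) γ 0 1 = ENNReal.ofReal α := by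
  rw [pathELength_S2_eq hγ]
  have h1 : ∀ t ∈ Icc (0 : ℝ) 1, ‖derivWithin (fun s => (γ s : E3)) (Icc 0 1) t‖ₑ =
      ENNReal.ofReal α := by
    intro t ht
    rw [derivWithin_congr h (h t ht), (hasDerivAt_great_arc p e α t).hasDerivWithinAt.derivWithin
      (uniqueDiffOn_Icc one_pos t ht), ← ofReal_norm, norm_smul, Real.norm_of_nonneg hα]
    have := great_arc_mem_sphere he hp ((real_inner_comm _ _).trans hpe) (-(α * t))
    rw [mem_sphere_zero_iff_norm, Real.cos_neg, Real.sin_neg, neg_smul, ← sub_eq_add_neg] at this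
    rw [this, mul_one]
  rw [MeasureTheory.setLIntegral_congr_fun measurableSet_Icc h1]
  simp

/-- Cauchy–Schwarz after replacing `y` by its component orthogonal to `x`. It bounds how fast `⟪c,
y⟫` changes along a curve `c` in the sphere. -/
theorem abs_inner_le_sqrt_one_sub_sq {F : Type*} [NormedAddCommGroup F] [InnerProductSpace ℝ F]
    {x v y : F} (hx : ‖x‖ = 1) (hy : ‖y‖ = 1) (hv : ⟪x, v⟫ = 0) :
    |⟪v, y⟫| ≤ ‖v‖ * √(1 - ⟪x, y⟫ ^ 2) := by
  have h1 : ⟪v, y⟫ = ⟪v, y - ⟪x, y⟫ • x⟫ := by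
    rw [inner_sub_right, inner_smul_right, real_inner_comm x v, hv]; simp
  have h2 : ‖y - ⟪x, y⟫ • x‖ = √(1 - ⟪x, y⟫ ^ 2) := by
    rw [← Real.sqrt_sq (norm_nonneg _), norm_sub_sq_real, norm_smul, inner_smul_right,
      real_inner_comm x y, hx, hy]
    congr 1
    rw [Real.norm_eq_abs, mul_one, sq_abs]; ring
  rw [h1, ← h2]
  exact abs_real_inner_le_norm _ _

/-- A curve on the unit sphere from `x` to `y` is at least as long as the angle between `x`
and `y`. -/
theorem arccos_inner_le_integral {F : Type*} [NormedAddCommGroup F] [InnerProductSpace ℝ F]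
    {c : ℝ → F} (hc : ContDiffOn ℝ 1 c (Icc 0 1)) (hn : ∀ t, ‖c t‖ = 1) :
    Real.arccos ⟪c 0, c 1⟫ ≤ ∫ t in (0 : ℝ)..1, ‖derivWithin c (Icc 0 1) t‖ := by
  have hI : UniqueDiffOn ℝ (Icc (0 : ℝ) 1) := uniqueDiffOn_Icc one_pos
  have hd : ∀ t ∈ Icc (0 : ℝ) 1, HasDerivWithinAt c (derivWithin c (Icc 0 1) t) (Icc 0 1) t :=
    fun t ht => (hc.differentiableOn one_ne_zero t ht).hasDerivWithinAt
  have hcont : ContinuousOn (derivWithin c (Icc 0 1)) (Icc 0 1) :=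
    hc.continuousOn_derivWithin hI le_rfl
  have hcc' : ∀ t ∈ Icc (0 : ℝ) 1, ⟪c t, derivWithin c (Icc 0 1) t⟫ = 0 := by
    intro t ht
    have := eq_zero_of_hasDerivWithinAt_Icc_of_eqOn_const ht
      ((hd t ht).inner ℝ (hd t ht)) (fun s _ => by simp [hn] : ∀ s ∈ Icc (0 : ℝ) 1, _ = (1 : ℝ))
    rw [real_inner_comm (c t)] at this
    linarith
  set y := c 1 with hy
  have hle : ∀ t, |⟪c t, y⟫| ≤ 1 := fun t => by
    simpa [hn, hy] using abs_real_inner_le_norm (c t) y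
  -- `arcsin` is not differentiable at `±1`, and `⟪c t, y⟫ = 1` at `t = 1`. The factor `r < 1` stays
  -- away from these points; afterwards `r` tends to `1`.
  have key : ∀ r ∈ Ioo (0 : ℝ) 1, Real.arcsin (r * ⟪c 1, y⟫) - Real.arcsin (r * ⟪c 0, y⟫) ≤
      ∫ t in (0 : ℝ)..1, ‖derivWithin c (Icc 0 1) t‖ := by
    intro r hr
    have hlt : ∀ t, |r * ⟪c t, y⟫| < 1 := fun t => by
      rw [abs_mul, abs_of_pos hr.1]
      nlinarith [hle t, hr.1, hr.2, abs_nonneg ⟪c t, y⟫]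
    have hder : ∀ t ∈ Icc (0 : ℝ) 1, HasDerivWithinAt (fun t => Real.arcsin (r * ⟪c t, y⟫))
        (1 / √(1 - (r * ⟪c t, y⟫) ^ 2) * (r * ⟪derivWithin c (Icc 0 1) t, y⟫)) (Icc 0 1) t := by
      intro t ht
      have h1 : HasDerivWithinAt (fun t => r * ⟪c t, y⟫)
          (r * ⟪derivWithin c (Icc 0 1) t, y⟫) (Icc 0 1) t := by
        have := ((hd t ht).inner ℝ (hasDerivWithinAt_const t (Icc (0 : ℝ) 1) y)).const_mul r
        simpa using this
      exact (Real.hasDerivAt_arcsin (abs_lt.1 (hlt t)).1.ne' (abs_lt.1 (hlt t)).2.ne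
        ).comp_hasDerivWithinAt t h1
    have hpos : ∀ t, 0 < 1 - (r * ⟪c t, y⟫) ^ 2 := fun t => by
      have := (sq_lt_one_iff_abs_lt_one _).2 (hlt t)
      linarith
    refine intervalIntegral.sub_le_integral_of_hasDeriv_right_of_le zero_le_one
      (fun t ht => (hder t ht).continuousWithinAt)
      (fun t ht => ((hder t (Ioo_subset_Icc_self ht)).mono_of_mem_nhdsWithin
        (Icc_mem_nhdsGT_of_mem (Ioo_subset_Ico_self ht))))
      (hcont.norm.integrableOn_Icc) fun t ht => ?_
    have ht' := Ioo_subset_Icc_self ht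
    have h1 := abs_inner_le_sqrt_one_sub_sq (hn t) (hn 1) (hcc' t ht')
    have h2 : √(1 - ⟪c t, y⟫ ^ 2) ≤ √(1 - (r * ⟪c t, y⟫) ^ 2) := by
      refine Real.sqrt_le_sqrt ?_
      rw [mul_pow]
      nlinarith [sq_nonneg ⟪c t, y⟫, hr.1, hr.2, mul_pos hr.1 (sub_pos.2 hr.2)]
    have h3 : 0 < √(1 - (r * ⟪c t, y⟫) ^ 2) := Real.sqrt_pos.2 (hpos t)
    rw [one_div, inv_mul_le_iff₀ h3]
    calc r * ⟪derivWithin c (Icc 0 1) t, y⟫ ≤ 1 * |⟪derivWithin c (Icc 0 1) t, y⟫| := by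
          nlinarith [le_abs_self ⟪derivWithin c (Icc 0 1) t, y⟫,
            abs_nonneg ⟪derivWithin c (Icc 0 1) t, y⟫, hr.1, hr.2]
      _ ≤ ‖derivWithin c (Icc 0 1) t‖ * √(1 - ⟪c t, y⟫ ^ 2) := by rw [one_mul]; exact h1
      _ ≤ ‖derivWithin c (Icc 0 1) t‖ * √(1 - (r * ⟪c t, y⟫) ^ 2) := by gcongr
      _ = _ := mul_comm _ _
  have hlim : Filter.Tendsto
      (fun r : ℝ => Real.arcsin (r * ⟪c 1, y⟫) - Real.arcsin (r * ⟪c 0, y⟫))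
      (nhdsWithin 1 (Iio 1)) (nhds (Real.arcsin (1 * ⟪c 1, y⟫) - Real.arcsin (1 * ⟪c 0, y⟫))) := by
    refine (Continuous.tendsto ?_ 1).mono_left nhdsWithin_le_nhds
    fun_prop
  have := le_of_tendsto hlim (by
    filter_upwards [Ioo_mem_nhdsLT (zero_lt_one (α := ℝ))] with r hr using key r hr)
  -- The limit is `π / 2 - arcsin ⟪c 0, c 1⟫`, the definition of `arccos`.
  rw [one_mul, one_mul, hy, real_inner_self_eq_norm_sq, hn, one_pow, Real.arcsin_one] at this
  exact this

theorem arccos_inner_le_riemannianEDist (x y : S2) :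
    ENNReal.ofReal (Real.arccos ⟪(x : E3), (y : E3)⟫) ≤ riemannianEDist 𝓘(ℝ, E2) x y := by
  refine le_of_forall_gt fun r hr => ?_
  obtain ⟨γ, h0, h1, hγ, hlt⟩ := exists_lt_of_riemannianEDist_lt hr
  refine lt_of_le_of_lt ?_ hlt
  have hc := hγ.coe_S2
  have hint : MeasureTheory.IntegrableOn
      (fun t => ‖derivWithin (fun s => (γ s : E3)) (Icc 0 1) t‖) (Icc 0 1) :=
    (hc.continuousOn_derivWithin (uniqueDiffOn_Icc one_pos) le_rfl).norm.integrableOn_Icc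
  have h := arccos_inner_le_integral hc (fun t => by simp)
  rw [intervalIntegral.integral_of_le zero_le_one,
    ← MeasureTheory.integral_Icc_eq_integral_Ioc] at h
  rw [pathELength_S2_eq hγ]
  simp only [← ofReal_norm]
  rw [← MeasureTheory.ofReal_integral_eq_lintegral_ofReal hint
    (Filter.Eventually.of_forall fun t => norm_nonneg _), ← h0, ← h1]
  exact ENNReal.ofReal_le_ofReal h

theorem IsGeodesic.contMDiffOn_one {γ : ℝ → S2} (hγ : IsGeodesic E2 γ) :
    ContMDiffOn 𝓘(ℝ, ℝ) 𝓘(ℝ, E2) 1 γ (Icc 0 1) :=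
  hγ.1.of_le (WithTop.coe_le_coe.2 (le_top : (1 : ℕ∞) ≤ ⊤))

theorem norm_coe_S2 (x : S2) : ‖(x : E3)‖ = 1 := by simp

/-! ### Minimizing geodesics and direction functions -/

/-- Great circle arcs of angle at most `π` are length minimizing. -/
theorem isMinGeodesic_greatCircle {x y : S2} {e : E3} (he : ‖e‖ = 1) (hxe : ⟪(x : E3), e⟫ = 0)
    {α : ℝ} (hα : α ∈ Icc 0 Real.pi) (hy : (y : E3) = Real.cos α • (x : E3) + Real.sin α • e) :
    IsMinGeodesic E2 (fun t => greatCircle (norm_coe_S2 x) he hxe (α * t)) x y ∧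
      riemannianEDist 𝓘(ℝ, E2) x y = ENNReal.ofReal α := by
  have hg := isGeodesic_greatCircle (norm_coe_S2 x) he hxe α
  have hl := pathELength_great_arc hg.contMDiffOn_one (norm_coe_S2 x) he hxe hα.1
    (fun t _ => rfl)
  have h0 : greatCircle (norm_coe_S2 x) he hxe (α * 0) = x := Subtype.ext (by simp [greatCircle])
  have h1 : greatCircle (norm_coe_S2 x) he hxe (α * 1) = y :=
    Subtype.ext (by simp [greatCircle, hy])
  have hle := riemannianEDist_le_pathELength hg.contMDiffOn_one h0 h1 zero_le_one
  have hge := arccos_inner_le_riemannianEDist x y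
  rw [hy, inner_add_right, inner_smul_right, inner_smul_right, hxe, real_inner_self_eq_norm_sq,
    norm_coe_S2, one_pow, mul_one, mul_zero, add_zero, Real.arccos_cos hα.1 hα.2] at hge
  rw [hl] at hle
  have hd := le_antisymm hle hge
  exact ⟨⟨hg, h0, h1, by rw [hl, hd]⟩, hd⟩

theorem exists_norm_eq_one_inner_eq_zero (x : E3) : ∃ e : E3, ‖e‖ = 1 ∧ ⟪x, e⟫ = 0 := by
  have h : (ℝ ∙ x)ᗮ ≠ ⊥ := by
    intro h
    rw [Submodule.orthogonal_eq_bot_iff] at h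
    have h1 := finrank_span_le_card (R := ℝ) ({x} : Set E3)
    rw [h, finrank_top] at h1
    simp at h1
  obtain ⟨v, hv, hv0⟩ := Submodule.exists_mem_ne_zero_of_ne_bot h
  rw [Submodule.mem_orthogonal_singleton_iff_inner_right] at hv
  exact ⟨‖v‖⁻¹ • v, norm_smul_inv_norm (𝕜 := ℝ) hv0, by rw [inner_smul_right, hv, mul_zero]⟩

theorem exists_great_arc (x y : S2) : ∃ α ∈ Icc 0 Real.pi, ∃ e : E3, ‖e‖ = 1 ∧
    ⟪(x : E3), e⟫ = 0 ∧ (y : E3) = Real.cos α • (x : E3) + Real.sin α • e := by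
  have hle : |⟪(x : E3), (y : E3)⟫| ≤ 1 := by
    simpa using abs_real_inner_le_norm (x : E3) (y : E3)
  refine ⟨Real.arccos ⟪(x : E3), (y : E3)⟫, ⟨Real.arccos_nonneg _, Real.arccos_le_pi _⟩, ?_⟩
  rw [Real.cos_arccos (abs_le.1 hle).1 (abs_le.1 hle).2, Real.sin_arccos]
  set w : E3 := (y : E3) - ⟪(x : E3), (y : E3)⟫ • (x : E3) with hw
  have hxw : ⟪(x : E3), w⟫ = 0 := by
    rw [hw, inner_sub_right, inner_smul_right, real_inner_self_eq_norm_sq, norm_coe_S2]; ring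
  have hnw : ‖w‖ = √(1 - ⟪(x : E3), (y : E3)⟫ ^ 2) := by
    rw [← Real.sqrt_sq (norm_nonneg w), hw, norm_sub_sq_real, norm_smul, inner_smul_right,
      real_inner_comm (x : E3) (y : E3), norm_coe_S2, norm_coe_S2]
    congr 1
    rw [Real.norm_eq_abs, mul_one, sq_abs]; ring
  rw [← hnw]
  -- If `w = 0`, then `y = ±x` and the sine of the angle vanishes, so any unit vector orthogonal to
  -- `x` serves as `e`.
  rcases eq_or_ne w 0 with h | h
  · obtain ⟨e, he, hxe⟩ := exists_norm_eq_one_inner_eq_zero (x : E3)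
    refine ⟨e, he, hxe, ?_⟩
    rw [h, norm_zero, zero_smul, add_zero]
    exact sub_eq_zero.1 (hw ▸ h)
  · refine ⟨‖w‖⁻¹ • w, norm_smul_inv_norm (𝕜 := ℝ) h,
      by rw [inner_smul_right, hxw, mul_zero], ?_⟩
    rw [smul_smul, mul_inv_cancel₀ (norm_ne_zero_iff.2 h), one_smul, hw, add_sub_cancel]

/-- The length of the arc is its angle `α`; minimality equates it with the distance, which is the
angle at most `π` of the arc given by `exists_great_arc`. -/
theorem IsMinGeodesic.exists_great_arc {γ : ℝ → S2} {x y : S2} (hγ : IsMinGeodesic E2 γ x y)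
    (hxy : x ≠ y) : ∃ α ∈ Ioc 0 Real.pi, ∃ e : E3, ‖e‖ = 1 ∧ ⟪(x : E3), e⟫ = 0 ∧
      ∀ t ∈ Icc (0 : ℝ) 1,
        (γ t : E3) = Real.cos (α * t) • (x : E3) + Real.sin (α * t) • e := by
  obtain ⟨hg, h0, h1, hl⟩ := hγ
  rcases hg.eq_const_or_great_arc with h | ⟨α, hα, e, he, hxe, h⟩
  · exact absurd (h0.symm.trans ((h 1 ⟨zero_le_one, le_rfl⟩).symm.trans h1)) hxy
  · rw [h0] at hxe h
    refine ⟨α, ⟨hα, ?_⟩, e, he, hxe, h⟩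
    obtain ⟨β, hβ, e', he', hxe', hy⟩ := _root_.exists_great_arc x y
    rw [(isMinGeodesic_greatCircle he' hxe' hβ hy).2,
      pathELength_great_arc hg.contMDiffOn_one (norm_coe_S2 x) he hxe hα.le h] at hl
    exact ((ENNReal.ofReal_le_ofReal_iff hβ.1).1 hl.le).trans hβ.2

theorem nonempty_directionFunction (p : S2) : Nonempty (DirectionFunction E2 p) := by
  have h : ∀ x : S2, (minDirections E2 p x).Nonempty := by
    intro x
    obtain ⟨α, hα, e, he, hpe, hx⟩ := exists_great_arc p x
    have hm := (isMinGeodesic_greatCircle he hpe hα hx).1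
    -- With an opaque `γ`, the point `p` can be replaced by `γ 0`, so that the velocity lies in
    -- `T_p` without transport.
    obtain ⟨γ, hγ⟩ : ∃ γ, IsMinGeodesic E2 γ p x := ⟨_, hm⟩
    obtain rfl := hγ.2.1
    exact ⟨_, γ, hγ, rfl⟩
  exact ⟨⟨fun x => (h x).some, fun x => (h x).some_mem⟩⟩

/-! ### Polar coordinates, the contraction and equatorial arcs -/

theorem northPole_coord : (northPole : E3) 0 = 0 ∧ (northPole : E3) 1 = 0 ∧
    (northPole : E3) 2 = 1 := by
  simp [northPole]

theorem inner_E3 (x y : E3) : ⟪x, y⟫ = x 0 * y 0 + x 1 * y 1 + x 2 * y 2 := by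
  simp [PiLp.inner_apply, Fin.sum_univ_three]
  ring

theorem northPole_ne_of_mem_equator {x : S2} (hx : x ∈ equator) : northPole ≠ x := by
  rintro rfl
  exact one_ne_zero (northPole_coord.2.2.symm.trans hx)

/-- The half contraction towards the north pole moves the equator to colatitude `π / 4`. -/
theorem radialContraction_half_of_mem_equator (η : DirectionFunction E2 northPole) {x : S2}
    (hx : x ∈ equator) : (η.radialContraction (1 / 2) x : E3) =
      Real.cos (Real.pi / 4) • (northPole : E3) + Real.sin (Real.pi / 4) • (x : E3) := by
  -- Only minimality of the chosen geodesic is needed: an endpoint of height `0` forces the angle `π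
  -- / 2` and `e = x`.
  have hmin := (η.mem_minDirections x).choose_spec.1
  obtain ⟨α, hα, e, he, hpe, h⟩ := hmin.exists_great_arc (northPole_ne_of_mem_equator hx)
  have h1 := h 1 ⟨zero_le_one, le_rfl⟩
  rw [hmin.2.2.1, mul_one] at h1
  obtain ⟨n0, n1, n2⟩ := northPole_coord
  have he2 : e 2 = 0 := by
    rw [inner_E3, n0, n1, n2] at hpe
    linarith
  have hx2 : Real.cos α = 0 := by
    have : (x : E3) 2 = 0 := hx
    rw [h1] at this
    simpa [n2, he2] using this
  have hα2 : α = Real.pi / 2 := Real.injOn_cos ⟨hα.1.le, hα.2⟩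
    ⟨by positivity, by linarith [Real.pi_pos]⟩ (by rw [hx2, Real.cos_pi_div_two])
  subst hα2
  have hxe : (x : E3) = e := by
    rw [h1, Real.cos_pi_div_two, Real.sin_pi_div_two, zero_smul, zero_add, one_smul]
  have h2 := h (1 / 2) ⟨by norm_num, by norm_num⟩
  rw [show Real.pi / 2 * (1 / 2) = Real.pi / 4 by ring, ← hxe] at h2
  exact h2

theorem polar_coord (θ φ : ℝ) : (polar θ φ : E3) 0 = Real.sin θ * Real.cos φ ∧
    (polar θ φ : E3) 1 = Real.sin θ * Real.sin φ ∧ (polar θ φ : E3) 2 = Real.cos θ := by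
  simp [polar]

theorem ext_E3 {x y : E3} (h0 : x 0 = y 0) (h1 : x 1 = y 1) (h2 : x 2 = y 2) : x = y := by
  ext i
  fin_cases i <;> assumption

theorem radialContraction_half_polar (η : DirectionFunction E2 northPole) (φ : ℝ) :
    η.radialContraction (1 / 2) (polar (Real.pi / 2) φ) = polar (Real.pi / 4) φ := by
  have hx : polar (Real.pi / 2) φ ∈ equator := by
    change (polar (Real.pi / 2) φ : E3) 2 = 0
    rw [(polar_coord _ _).2.2, Real.cos_pi_div_two]
  refine Subtype.ext ?_
  rw [radialContraction_half_of_mem_equator η hx]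
  obtain ⟨n0, n1, n2⟩ := northPole_coord
  apply ext_E3 <;> simp [n0, n1, n2, polar_coord]

theorem exists_polar_of_mem_equator {x : S2} (hx : x ∈ equator) :
    ∃ a : ℝ, (x : E3) 0 = Real.cos a ∧ (x : E3) 1 = Real.sin a := by
  have hn := norm_coe_S2 x
  have h1 : (x : E3) 0 ^ 2 + (x : E3) 1 ^ 2 = 1 := by
    have h2 : (x : E3) 2 = 0 := hx
    have := real_inner_self_eq_norm_sq (x : E3)
    rw [hn, inner_E3, h2] at this
    linarith
  set z : ℂ := ⟨(x : E3) 0, (x : E3) 1⟩ with hz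
  have hzn : ‖z‖ = 1 := by
    rw [Complex.norm_def, Complex.normSq_mk, Real.sqrt_eq_one]; linarith
  have hz0 : z ≠ 0 := norm_ne_zero_iff.1 (by rw [hzn]; exact one_ne_zero)
  exact ⟨z.arg, by rw [Complex.cos_arg hz0, hzn, div_one], by rw [Complex.sin_arg, hzn, div_one]⟩

/-- A great circle arc in the equator is a linear function of the longitude. -/
theorem exists_polar_great_arc {x : S2} (hx : x ∈ equator) {e : E3} (he : ‖e‖ = 1)
    (hxe : ⟪(x : E3), e⟫ = 0) (he2 : e 2 = 0) :
    ∃ a s : ℝ, |s| = 1 ∧ ∀ τ, Real.cos τ • (x : E3) + Real.sin τ • e =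
      polar (Real.pi / 2) (a + s * τ) := by
  obtain ⟨a, h0, h1⟩ := exists_polar_of_mem_equator hx
  have h2 : (x : E3) 2 = 0 := hx
  have hn := real_inner_self_eq_norm_sq e
  rw [inner_E3, he2, he] at hn
  rw [inner_E3, h0, h1, he2] at hxe
  have ha := Real.sin_sq_add_cos_sq a
  -- `s` is the component of `e` along the eastward unit vector `(-sin a, cos a, 0)`; its sign is
  -- the sense of travel.
  set s := e 1 * Real.cos a - e 0 * Real.sin a with hs
  have e0 : e 0 = -s * Real.sin a := by
    rw [hs]; linear_combination (-e 0) * ha + Real.cos a * hxe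
  have e1 : e 1 = s * Real.cos a := by
    rw [hs]; linear_combination (-e 1) * ha + Real.sin a * hxe
  have hs2 : s ^ 2 = 1 := by
    rw [e0, e1] at hn; linear_combination hn - s ^ 2 * ha
  have hs1 : s = 1 ∨ s = -1 := mul_self_eq_one_iff.1 (by rw [← sq, hs2])
  refine ⟨a, s, ?_, fun τ => ?_⟩
  · rcases hs1 with h | h <;> simp [h]
  have hc : Real.cos (s * τ) = Real.cos τ ∧ Real.sin (s * τ) = s * Real.sin τ := by
    rcases hs1 with h | h <;> simp [h]
  apply ext_E3
  · simp [polar_coord, h0, e0, Real.cos_add, hc]; ring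
  · simp [polar_coord, h1, e1, Real.sin_add, hc]; ring
  · simp [polar_coord, h2, he2]

theorem exists_isMinGeodesic_mapsTo_equator {x y : S2} (hx : x ∈ equator) (hy : y ∈ equator) :
    ∃ γ : ℝ → S2, IsMinGeodesic E2 γ x y ∧ MapsTo γ (Icc 0 1) equator := by
  have hx2 : (x : E3) 2 = 0 := hx
  have hy2 : (y : E3) 2 = 0 := hy
  obtain ⟨α, hα, e, he, hxe, h, hs⟩ : ∃ α ∈ Icc 0 Real.pi, ∃ e : E3, ‖e‖ = 1 ∧
      ⟪(x : E3), e⟫ = 0 ∧ (y : E3) = Real.cos α • (x : E3) + Real.sin α • e ∧ e 2 = 0 := by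
    obtain ⟨α, hα, e, he, hxe, h⟩ := exists_great_arc x y
    -- When `sin α = 0` the vector `e` does not affect the endpoint, so it may be replaced by a
    -- horizontal one; otherwise the height of `y` forces `e` to be horizontal.
    rcases eq_or_ne (Real.sin α) 0 with h0 | h0
    · obtain ⟨a, h0', h1'⟩ := exists_polar_of_mem_equator hx
      refine ⟨α, hα, !₂[-Real.sin a, Real.cos a, 0], ?_, ?_, ?_, by simp⟩
      · simp [EuclideanSpace.norm_eq, Fin.sum_univ_three]
      · simp [inner_E3, h0', h1']; ring
      · rw [h, h0, zero_smul, zero_smul]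
    · refine ⟨α, hα, e, he, hxe, h, ?_⟩
      rw [h] at hy2
      simpa [hx2, h0] using hy2
  refine ⟨_, (isMinGeodesic_greatCircle he hxe hα h).1, fun t _ => ?_⟩
  change (Real.cos (α * t) • (x : E3) + Real.sin (α * t) • e) 2 = 0
  simp [hx2, hs]

theorem IsMinGeodesic.eq_polar {γ : ℝ → S2} {x y : S2} (hx : x ∈ equator) (hy : y ∈ equator)
    (hxy : x ≠ y) (hγ : IsMinGeodesic E2 γ x y) (hanti : y = -x → MapsTo γ (Icc 0 1) equator) :
    ∃ a b : ℝ, a ≠ b ∧ |b - a| ≤ Real.pi ∧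
      ∀ t ∈ Icc (0 : ℝ) 1, γ t = polar (Real.pi / 2) (a + t * (b - a)) := by
  have hx2 : (x : E3) 2 = 0 := hx
  obtain ⟨α, hα, e, he, hxe, h⟩ := hγ.exists_great_arc hxy
  have he2 : e 2 = 0 := by
    have h1 := h 1 ⟨zero_le_one, le_rfl⟩
    rw [hγ.2.2.1, mul_one] at h1
    rcases hα.2.lt_or_eq with hlt | rfl
    · have hy2 : (y : E3) 2 = 0 := hy
      rw [h1] at hy2
      simpa [hx2, (Real.sin_pos_of_pos_of_lt_pi hα.1 hlt).ne'] using hy2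
    -- For `α = π` the endpoint says nothing about `e`, but the midpoint of the arc is `e` itself.
    · have hyx : y = -x := Subtype.ext (by simp [h1])
      have hm : (γ (1 / 2) : E3) 2 = 0 := hanti hyx ⟨by norm_num, by norm_num⟩
      rw [h (1 / 2) ⟨by norm_num, by norm_num⟩, mul_one_div] at hm
      simpa [hx2] using hm
  obtain ⟨a, s, hs, hp⟩ := exists_polar_great_arc hx he hxe he2
  have hs0 : s ≠ 0 := fun h0 => by simp [h0] at hs
  refine ⟨a, a + s * α, ?_, ?_, fun t ht => Subtype.ext ?_⟩
  · simpa using ⟨hs0, hα.1.ne'⟩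
  · rw [add_sub_cancel_left, abs_mul, hs, one_mul, abs_of_pos hα.1]
    exact hα.2
  · rw [h t ht, hp]
    congr 2
    ring

/-! ### Latitude circles other than the equator contain no nonconstant geodesic -/

/-- A geodesic inside a latitude circle other than the equator is constant. -/
theorem IsGeodesic.eq_const_of_height_eq {σ : ℝ → S2} (hσ : IsGeodesic E2 σ) {k : ℝ} (hk : k ≠ 0)
    (h : ∀ t ∈ Icc (0 : ℝ) 1, (σ t : E3) 2 = k) : ∀ t ∈ Icc (0 : ℝ) 1, σ t = σ 0 := by
  rcases hσ.eq_const_or_great_arc with h' | ⟨α, hα, e, -, -, h'⟩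
  · exact h'
  · exfalso
    have hf : ∀ t ∈ Icc (0 : ℝ) 1, Real.cos (α * t) * k + Real.sin (α * t) * e 2 = k := by
      intro t ht
      have := h t ht
      rw [h' t ht] at this
      simpa [h 0 ⟨le_rfl, zero_le_one⟩] using this
    -- Both `s` and `2 * s` must be admissible times, and `0 < α * s ≤ 1 < π` makes `cos (α * s) <
    -- 1`. Comparing the heights at these times by the double angle formulas eliminates `e 2`.
    obtain ⟨s, hs0, hs1, hsα⟩ : ∃ s > 0, 2 * s ≤ 1 ∧ α * s ≤ 1 := by
      refine ⟨min (1 / 2) α⁻¹, by positivity, ?_, ?_⟩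
      · linarith [min_le_left (1 / 2) α⁻¹]
      · rw [← mul_inv_cancel₀ hα.ne']
        exact mul_le_mul_of_nonneg_left (min_le_right _ _) hα.le
    have h1 := hf s ⟨hs0.le, by linarith⟩
    have h2 := hf (2 * s) ⟨by linarith, hs1⟩
    rw [show α * (2 * s) = 2 * (α * s) by ring, Real.cos_two_mul, Real.sin_two_mul] at h2
    have h3 : k * (1 - Real.cos (α * s)) = 0 := by linear_combination Real.cos (α * s) * h1 - h2 / 2
    have h4 : Real.cos (α * s) < 1 := by
      rw [← Real.cos_zero]
      exact Real.cos_lt_cos_of_nonneg_of_le_pi le_rfl (hsα.trans (by linarith [Real.pi_gt_three]))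
        (mul_pos hα hs0)
    rcases mul_eq_zero.1 h3 with h5 | h5
    · exact hk h5
    · linarith

/-- The height is `cos θ ≠ 0` on `A`, so a geodesic with image `A` would be constant, whereas `A`
has two points. -/
theorem not_exists_isGeodesic_image_eq {θ : ℝ} (hθ : Real.cos θ ≠ 0) {A : Set S2}
    (hA : A ⊆ latitudeCircle θ) (hA' : A.Nontrivial) :
    ¬ ∃ σ : ℝ → S2, IsGeodesic E2 σ ∧ σ '' Icc 0 1 = A := by
  rintro ⟨σ, hσ, rfl⟩
  have hc := hσ.eq_const_of_height_eq hθ fun t ht => by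
    obtain ⟨φ, hφ⟩ := hA (mem_image_of_mem σ ht)
    rw [← hφ, (polar_coord _ _).2.2]
  obtain ⟨_, ⟨t, ht, rfl⟩, _, ⟨t', ht', rfl⟩, hne⟩ := hA'
  exact hne ((hc t ht).trans (hc t' ht').symm)

theorem polar_ne_polar {θ a b : ℝ} (hθ : Real.sin θ ≠ 0) (hab : a ≠ b) (hπ : |b - a| ≤ Real.pi) :
    polar θ a ≠ polar θ b := by
  intro h
  have h0 : Real.cos a = Real.cos b := by
    have := (polar_coord θ a).1
    rw [h, (polar_coord θ b).1] at this
    exact (mul_left_cancel₀ hθ this).symm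
  have h1 : Real.sin a = Real.sin b := by
    have := (polar_coord θ a).2.1
    rw [h, (polar_coord θ b).2.1] at this
    exact (mul_left_cancel₀ hθ this).symm
  have h2 : Real.cos (b - a) = 1 := by
    rw [Real.cos_sub, h0, h1]
    linarith [Real.sin_sq_add_cos_sq b]
  -- Equal points have longitudes differing by a multiple of `2π`, and `|b - a| ≤ π < 2π` leaves
  -- only `0`.
  have h3 := (Real.cos_eq_one_iff_of_lt_of_lt
    (by linarith [(abs_le.1 hπ).1, Real.pi_pos]) (by linarith [(abs_le.1 hπ).2, Real.pi_pos])).1 h2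
  exact hab (by linarith)

theorem mainTheorem7 :
    -- direction functions at the north pole exist
    Nonempty (DirectionFunction E2 northPole) ∧
    (∀ x ∈ equator, ∀ y ∈ equator, x ≠ y →
      -- a length minimizing geodesic from `x` to `y` exists along the equator
      (∃ γ : ℝ → S2, IsMinGeodesic E2 γ x y ∧ MapsTo γ (Icc 0 1) equator) ∧
      -- the half contraction of any such geodesic
      ∀ (η : DirectionFunction E2 northPole) (γ : ℝ → S2), IsMinGeodesic E2 γ x y →
        (y = -x → MapsTo γ (Icc 0 1) equator) →
        -- is an arc of the latitude circle of colatitude `π / 4`,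
        (∃ a b : ℝ, a ≠ b ∧ |b - a| ≤ Real.pi ∧ ∀ t ∈ Icc (0 : ℝ) 1,
          γ t = polar (Real.pi / 2) (a + t * (b - a)) ∧
          η.radialContraction (1 / 2) (γ t) = polar (Real.pi / 4) (a + t * (b - a))) ∧
        -- is not a geodesic,
        ¬ IsGeodesic E2 (fun t => η.radialContraction (1 / 2) (γ t)) ∧
        -- and does not become one after a change of parametrization
        ¬ ∃ σ : ℝ → S2, IsGeodesic E2 σ ∧
          σ '' Icc 0 1 = η.radialContraction (1 / 2) '' (γ '' Icc 0 1)) ∧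
    -- the latitude circle itself is not a geodesic either
    ¬ ∃ σ : ℝ → S2, IsGeodesic E2 σ ∧ σ '' Icc 0 1 = latitudeCircle (Real.pi / 4) := by
  have hcos : Real.cos (Real.pi / 4) ≠ 0 :=
    (Real.cos_pos_of_mem_Ioo ⟨by linarith [Real.pi_pos], by linarith [Real.pi_pos]⟩).ne'
  have hsin : Real.sin (Real.pi / 4) ≠ 0 :=
    (Real.sin_pos_of_pos_of_lt_pi (by positivity) (by linarith [Real.pi_pos])).ne'
  refine ⟨nonempty_directionFunction northPole, fun x hx y hy hxy =>
    ⟨exists_isMinGeodesic_mapsTo_equator hx hy, fun η γ hγ hanti => ?_⟩, ?_⟩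
  · obtain ⟨a, b, hab, hπ, h⟩ := hγ.eq_polar hx hy hxy hanti
    have hη : ∀ t ∈ Icc (0 : ℝ) 1,
        η.radialContraction (1 / 2) (γ t) = polar (Real.pi / 4) (a + t * (b - a)) := fun t ht => by
      rw [h t ht, radialContraction_half_polar]
    have himage : ¬ ∃ σ : ℝ → S2, IsGeodesic E2 σ ∧
        σ '' Icc 0 1 = η.radialContraction (1 / 2) '' (γ '' Icc 0 1) := by
      refine not_exists_isGeodesic_image_eq hcos ?_
        ⟨_, mem_image_of_mem _ (mem_image_of_mem γ (left_mem_Icc.2 zero_le_one)),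
          _, mem_image_of_mem _ (mem_image_of_mem γ (right_mem_Icc.2 zero_le_one)), ?_⟩
      · rintro _ ⟨_, ⟨t, ht, rfl⟩, rfl⟩
        exact ⟨_, (hη t ht).symm⟩
      · rw [hη 0 (left_mem_Icc.2 zero_le_one), hη 1 (right_mem_Icc.2 zero_le_one), zero_mul,
          add_zero, one_mul, add_sub_cancel]
        exact polar_ne_polar hsin hab hπ
    -- The contracted curve has the excluded image, so it would itself be a forbidden `σ`.
    refine ⟨⟨a, b, hab, hπ, fun t ht => ⟨h t ht, hη t ht⟩⟩, fun hg => himage ⟨_, hg, ?_⟩, himage⟩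
    rw [image_image]
  · exact not_exists_isGeodesic_image_eq hcos subset_rfl
      ⟨_, ⟨0, rfl⟩, _, ⟨Real.pi, rfl⟩, polar_ne_polar hsin Real.pi_ne_zero.symm
        (by rw [sub_zero, abs_of_pos Real.pi_pos])⟩
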